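/- Let \(G\) be a non-discrete, non-compact, locally compact second countable (Hausdorff) group acting freely on a standard Borel space \(X\) in such a way that the action map \(G\times X\to X\) is Borel. Let \(E_G\) be the orbit equivalence relation and let \(\rho:E_G\to G\) be its cocycle, defined by \(\rho(x,y)\cdot x=y\). For \(\mathcal C\subseteq X\) let \(E_{\mathcal C}\) be the restriction of \(E_G\) to \(\mathcal C\), and for \(x\in X\) put \(\phi_{\mathcal C}(x)=\{g\in G: g^{-1}x\in\mathcal C\}\). A *Borel cross-section* is a Borel set \(\mathcal C\subseteq X\) that meets every orbit and for which \(\phi_{\mathcal C}(x)\) is a closed discrete subset of \(G\) for every \(x\in X\). It is *lacunary* if there is a neighborhood \(U\) of the identity of \(G\) such that \((U\cdot x)\cap(U\cdot y)=\varnothing\) for all distinct \(x,y\in\mathcal C\), and it is *separating* if the map \(x\mapsto\phi_{\mathcal C}(x)\) is injective on \(X\). Let \(\Gamma\le G\) be a countable dense subgroup and let \(\mathcal C\) be a lacunary Borel cross-section with \(\rho(E_{\mathcal C})\subseteq\Gamma\). Then there exists a lacunary separating Borel cross-section \(\mathcal D\supseteq\mathcal C\) with \(\rho(E_{\mathcal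 D})\subseteq\Gamma\). -/

import Mathlib

open Topology MeasureTheory

/-- The orbit equivalence relation `E_G` on `X`, as a set of pairs. -/
def orbitEquivRel (G X : Type*) [Group G] [MulAction G X] : Set (X × X) :=
  {p | p.2 ∈ MulAction.orbit G p.1}

/-- The restriction `E_C` of the orbit equivalence relation to a set `C`. -/
def orbitEquivRelOn (G : Type*) {X : Type*} [Group G] [MulAction G X] (C : Set X) :
    Set (orbitEquivRel G X) :=
  {p | p.1.1 ∈ C ∧ p.1.2 ∈ C}

/-- The cocycle `ρ : E_G → G`: `ρ(x, y)` is an element with `ρ(x, y) • x = y`; it is the only one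
when the action is free, see `orbitCocycle_unique`. -/
noncomputable def orbitCocycle {G X : Type*} [Group G] [MulAction G X]
    (p : orbitEquivRel G X) : G :=
  Classical.choose (MulAction.mem_orbit_iff.mp p.2)

theorem orbitCocycle_smul {G X : Type*} [Group G] [MulAction G X] (p : orbitEquivRel G X) :
    orbitCocycle p • p.1.1 = p.1.2 :=
  Classical.choose_spec (MulAction.mem_orbit_iff.mp p.2)

theorem orbitCocycle_unique {G X : Type*} [Group G] [MulAction G X]
    (hfree : ∀ (g : G) (x : X), g • x = x → g = 1) (p : orbitEquivRel G X) (g : G)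
    (hg : g • p.1.1 = p.1.2) : orbitCocycle p = g := by
  have h : (g⁻¹ * orbitCocycle p) • p.1.1 = p.1.1 := by
    rw [mul_smul, orbitCocycle_smul, ← hg, inv_smul_smul]
  exact (inv_mul_eq_one.mp (hfree _ _ h)).symm

/-- The set `φ(x) = {g ∈ G : g⁻¹ • x ∈ C}`. -/
def visitSet (G : Type*) {X : Type*} [Group G] [MulAction G X] (C : Set X) (x : X) : Set G :=
  {g | g⁻¹ • x ∈ C}

/-- A Borel cross-section: a Borel set that meets every orbit, and does so in a discrete set.
Discrete subsets of `G` are understood as elements of the space of closed subsets of `G`, hence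
they are closed. -/
structure IsBorelCrossSection (G : Type*) {X : Type*} [Group G] [TopologicalSpace G]
    [MeasurableSpace X] [MulAction G X] (C : Set X) : Prop where
  measurableSet : MeasurableSet C
  meets_orbit : ∀ x : X, (MulAction.orbit G x ∩ C).Nonempty
  isClosed_visitSet : ∀ x : X, IsClosed (visitSet G C x)
  discrete_visitSet : ∀ x : X, DiscreteTopology (visitSet G C x)

/-- `C` is `U`-lacunary: `(U • x) ∩ (U • y) = ∅` for distinct `x, y ∈ C`. -/
def IsLacunaryWith {G X : Type*} [Group G] [MulAction G X] (U : Set G) (C : Set X) : Prop :=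
  ∀ x ∈ C, ∀ y ∈ C, x ≠ y → ((fun g : G => g • x) '' U) ∩ ((fun g : G => g • y) '' U) = ∅

/-- `C` is lacunary: it is `U`-lacunary for some neighborhood `U` of the identity. -/
def IsLacunary (G : Type*) {X : Type*} [Group G] [TopologicalSpace G] [MulAction G X]
    (C : Set X) : Prop :=
  ∃ U ∈ 𝓝 (1 : G), IsLacunaryWith U C

/-- `C` is separating: the map `x ↦ φ(x)` is injective. -/
def IsSeparating (G : Type*) {X : Type*} [Group G] [MulAction G X] (C : Set X) : Prop :=
  Function.Injective (visitSet G C)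

/-! The points of `C` are given labels, and the labels are then encoded by nearby extra points.
Inside `Γ • C` a Borel maximal `V`-independent `M ⊇ C` exists; density of `Γ` makes it syndetic
(`exists_syndetic_superset`). Since `G` is not compact, a syndetic set splits into two syndetic
sets, so `M` contains infinitely many disjoint syndetic sets `T n`
(`IsSyndetic.exists_disjoint_seq`). A point of `T n` is labelled by the finite pattern of its
returns to `M ∩ B n` within a compact window, where the `B n` separate points. Every point reaches
`T n` through that window, so the labelled returns tell whether it lies in `B n`
(`IsSyndetic.exists_generator`).

Since `G` is not discrete, there are small `a, s n ∈ Γ` with all configurations `{1, a, s n}`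
uniformly discrete and asymmetric (`exists_marker_elements`). Adding `a • c` and `s (f c) • c` to
each `c ∈ M` keeps the set lacunary, and its visit sets determine both `M` and the labels. -/

/-- No element of `K` other than `1` moves a point of `A` to a point of `A`. -/
def IndepSet {G X : Type*} [Group G] [MulAction G X] (K : Set G) (A : Set X) : Prop :=
  ∀ x ∈ A, ∀ g ∈ K, g • x ∈ A → g = 1

/-- The group elements moving points of `A` to points of `A` lie in `Γ`. -/
def ReturnsIn {G X : Type*} [Group G] [MulAction G X] (Γ : Subgroup G) (A : Set X) : Prop :=
  ∀ x ∈ A, ∀ g : G, g • x ∈ A → g ∈ Γ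

/-- Some compact set of group elements moves every point into `A`. -/
def IsSyndetic (G : Type*) {X : Type*} [Group G] [TopologicalSpace G] [MulAction G X]
    (A : Set X) : Prop :=
  ∃ L : Set G, IsCompact L ∧ ∀ x : X, ∃ g ∈ L, g • x ∈ A

theorem ReturnsIn.mono {G X : Type*} [Group G] [MulAction G X] {Γ : Subgroup G} {A B : Set X}
    (hB : ReturnsIn Γ B) (h : A ⊆ B) : ReturnsIn Γ A :=
  fun x hx g hg => hB x (h hx) g (h hg)

theorem IndepSet.mono {G X : Type*} [Group G] [MulAction G X] {K : Set G} {A B : Set X}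
    (hB : IndepSet K B) (h : A ⊆ B) : IndepSet K A :=
  fun x hx g hg hgx => hB x (h hx) g hg (h hgx)

theorem exists_nat_measurable_separating (X : Type*) [MeasurableSpace X] [StandardBorelSpace X] :
    ∃ B : ℕ → Set X, (∀ n, MeasurableSet (B n)) ∧
      ∀ (x : X) (F : Set X), F.Finite → x ∉ F → ∃ n, x ∈ B n ∧ ∀ y ∈ F, y ∉ B n := by
  let := upgradeStandardBorel X
  -- Inserting `∅` makes the family nonempty, so that `ℕ` enumerates it even when `X` is empty.
  obtain ⟨B, hB⟩ := ((TopologicalSpace.countable_countableBasis X).insert ∅).exists_eq_range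
    ⟨∅, Set.mem_insert _ _⟩
  refine ⟨B, fun n => ?_, fun x F hF hx => ?_⟩
  · have hn : B n ∈ insert ∅ (TopologicalSpace.countableBasis X) := hB ▸ Set.mem_range_self n
    rcases hn with hn | hn
    · rw [hn]; exact MeasurableSet.empty
    · exact ((TopologicalSpace.isBasis_countableBasis X).isOpen hn).measurableSet
  · obtain ⟨v, hv, hxv, hvF⟩ := (TopologicalSpace.isBasis_countableBasis X).exists_subset_of_mem_open
      (show x ∈ Fᶜ from hx) hF.isClosed.isOpen_compl
    have hv' : v ∈ Set.range B := hB ▸ Set.mem_insert_of_mem _ hv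
    obtain ⟨n, rfl⟩ := hv'
    exact ⟨n, hxv, fun y hy hyn => hvF hyn hy⟩

theorem exists_nhds_one_mul_inv_subset {G : Type*} [Group G] [TopologicalSpace G]
    [IsTopologicalGroup G] {V : Set G} (hV : V ∈ 𝓝 (1 : G)) :
    ∃ O ∈ 𝓝 (1 : G), ∀ p ∈ O, ∀ q ∈ O, p * q⁻¹ ∈ V := by
  obtain ⟨O, hO, h⟩ := exists_nhds_split_inv hV
  exact ⟨O, hO, fun p hp q hq => by simpa [div_eq_mul_inv] using h p hp q hq⟩

/-- The returns of a point to a uniformly discrete set are separated by right translates. -/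
theorem IndepSet.eq_of_mul_mem {G X : Type*} [Group G] [MulAction G X] {V O : Set G} {A : Set X}
    (hA : IndepSet V A) (hO : ∀ p ∈ O, ∀ q ∈ O, p * q⁻¹ ∈ V) {x : X} {g h k : G}
    (hg : g • x ∈ A) (hh : h • x ∈ A) (hgk : g * k⁻¹ ∈ O) (hhk : h * k⁻¹ ∈ O) : g = h := by
  have h1 : g * h⁻¹ ∈ V := by simpa using hO _ hgk _ hhk
  have := hA _ hh _ h1 (by rwa [smul_smul, inv_mul_cancel_right])
  exact mul_inv_eq_one.mp this

/-- Finitely many right translates of a small `O` cover `K`, and each holds at most one return. -/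
theorem IndepSet.finite_returns {G X : Type*} [Group G] [TopologicalSpace G]
    [IsTopologicalGroup G] [MulAction G X] {V K : Set G} {A : Set X}
    (hA : IndepSet V A) (hV : V ∈ 𝓝 (1 : G)) (hK : IsCompact K) (x : X) :
    {g ∈ K | g • x ∈ A}.Finite := by
  obtain ⟨O, hO, hOV⟩ := exists_nhds_one_mul_inv_subset hV
  have hnhds : ∀ k : G, {g | g * k⁻¹ ∈ O} ∈ 𝓝 k := fun k =>
    (continuous_mul_const k⁻¹).continuousAt.preimage_mem_nhds (by simpa using hO)
  obtain ⟨t, -, ht⟩ := hK.elim_nhds_subcover (fun k => {g | g * k⁻¹ ∈ O}) fun k _ => hnhds k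
  refine (t.finite_toSet.biUnion (t := fun k => {g | g * k⁻¹ ∈ O ∧ g • x ∈ A}) fun k _ => ?_).subset
    fun g hg => ?_
  · exact Set.Subsingleton.finite fun g hg h hh => hA.eq_of_mul_mem hOV hg.2 hh.2 hg.1 hh.1
  · obtain ⟨k, hk, hgk⟩ := Set.mem_iUnion₂.mp (ht hg.1)
    exact Set.mem_biUnion hk ⟨hgk, hg.2⟩

/-! ### Borel maximal independent sets -/

/-- A set with locally finite returns is a countable union of independent Borel sets. -/
theorem exists_nat_cover_indepSet {G X : Type*} [Group G] [MeasurableSpace G]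
    [MeasurableSpace X] [StandardBorelSpace X] [MulAction G X] [MeasurableConstSMul G X]
    (hfree : ∀ (g : G) (x : X), g • x = x → g = 1)
    {Γ : Subgroup G} (hΓ : (Γ : Set G).Countable) {K : Set G} {A : Set X}
    (hA : MeasurableSet A) (hret : ReturnsIn Γ A)
    (hfin : ∀ x, {g ∈ K | g • x ∈ A}.Finite) :
    ∃ P : ℕ → Set X, (∀ n, MeasurableSet (P n)) ∧ (∀ n, IndepSet K (P n)) ∧ ⋃ n, P n = A := by
  obtain ⟨B, hBm, hB⟩ := exists_nat_measurable_separating X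
  -- `P n` keeps the points of `A ∩ B n` with no `K`-neighbour there. Neighbours come from `Γ`, so
  -- the union is countable.
  refine ⟨fun n => (A ∩ B n) \ ⋃ g ∈ {g ∈ (Γ : Set G) | g ∈ K ∧ g ≠ 1}, (g • ·) ⁻¹' (A ∩ B n),
    fun n => ?_, fun n x hx g hg hgx => ?_, ?_⟩
  · refine (hA.inter (hBm n)).diff (MeasurableSet.biUnion (hΓ.mono fun g hg => hg.1) fun g _ => ?_)
    exact measurable_const_smul g (hA.inter (hBm n))
  · by_contra hne
    exact hx.2 (Set.mem_biUnion (x := g) ⟨hret x hx.1.1 g hgx.1.1, hg, hne⟩ hgx.1)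
  · refine Set.Subset.antisymm (Set.iUnion_subset fun n x hx => hx.1.1) fun x hx => ?_
    obtain ⟨n, hxn, hn⟩ := hB x ((· • x) '' {g ∈ K | g • x ∈ A ∧ g ≠ 1})
      (((hfin x).subset fun g hg => ⟨hg.1, hg.2.1⟩).image _)
      (by rintro ⟨g, ⟨-, -, hg⟩, hgx⟩; exact hg (hfree g x hgx))
    refine Set.mem_iUnion.mpr ⟨n, ⟨hx, hxn⟩, fun hmem => ?_⟩
    obtain ⟨g, ⟨-, hgK, hg1⟩, hgA, hgB⟩ := Set.mem_iUnion₂.mp hmem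
    exact hn _ ⟨g, ⟨hgK, hgA, hg1⟩, rfl⟩ hgB

/-- Greedy choice: stage `n` adds all points of `P n` not `K`-adjacent to the set built so far. They
cannot conflict with each other because `P n` is independent. -/
theorem exists_maximal_indepSet_of_iUnion {G X : Type*} [Group G] [MeasurableSpace G]
    [MeasurableSpace X] [MulAction G X] [MeasurableConstSMul G X]
    {Γ : Subgroup G} (hΓ : (Γ : Set G).Countable) {K : Set G} (h1 : (1 : G) ∈ K)
    (hinv : ∀ g ∈ K, g⁻¹ ∈ K) {P : ℕ → Set X} (hP : ∀ n, MeasurableSet (P n))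
    (hPK : ∀ n, IndepSet K (P n)) (hret : ReturnsIn Γ (⋃ n, P n))
    {M₀ : Set X} (hM₀ : MeasurableSet M₀) (hM₀K : IndepSet K M₀) (hM₀P : M₀ ⊆ ⋃ n, P n) :
    ∃ M : Set X, MeasurableSet M ∧ M₀ ⊆ M ∧ M ⊆ ⋃ n, P n ∧ IndepSet K M ∧
      ∀ x ∈ ⋃ n, P n, ∃ g ∈ K, g • x ∈ M := by
  let step : ℕ → Set X → Set X := fun n M =>
    M ∪ (P n \ ⋃ g ∈ {g ∈ (Γ : Set G) | g ∈ K}, (g • ·) ⁻¹' M)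
  let M : ℕ → Set X := fun n => Nat.rec M₀ step n
  have hsucc : ∀ n, M (n + 1) = M n ∪ (P n \ ⋃ g ∈ {g ∈ (Γ : Set G) | g ∈ K}, (g • ·) ⁻¹' M n) :=
    fun n => rfl
  have hmono : Monotone M := monotone_nat_of_le_succ fun n => by
    rw [hsucc]; exact Set.subset_union_left
  have hsub : ∀ n, M n ⊆ ⋃ n, P n := fun n => by
    induction n with
    | zero => exact hM₀P
    | succ n ih =>
      rw [hsucc]
      exact Set.union_subset ih (Set.sdiff_subset.trans (Set.subset_iUnion P n))
  have hmeas : ∀ n, MeasurableSet (M n) := fun n => by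
    induction n with
    | zero => exact hM₀
    | succ n ih =>
      rw [hsucc]
      exact ih.union ((hP n).diff (MeasurableSet.biUnion (hΓ.mono fun g hg => hg.1)
        fun g _ => measurable_const_smul g ih))
  have hind : ∀ n, IndepSet K (M n) := fun n => by
    induction n with
    | zero => exact hM₀K
    | succ n ih =>
      intro x hx g hg hgx
      have hgΓ : g ∈ Γ := hret x (hsub (n + 1) hx) g (hsub (n + 1) hgx)
      rw [hsucc] at hx hgx
      rcases hx with hx | hx <;> rcases hgx with hgx | hgx
      · exact ih x hx g hg hgx
      · refine (hgx.2 (Set.mem_biUnion (x := g⁻¹) ⟨Γ.inv_mem hgΓ, hinv g hg⟩ ?_)).elim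
        simpa using hx
      · exact (hx.2 (Set.mem_biUnion (x := g) ⟨hgΓ, hg⟩ hgx)).elim
      · exact hPK n x hx.1 g hg hgx.1
  refine ⟨⋃ n, M n, MeasurableSet.iUnion hmeas, Set.subset_iUnion M 0, Set.iUnion_subset hsub,
    fun x hx g hg hgx => ?_, fun x hx => ?_⟩
  · obtain ⟨m, hm⟩ := Set.mem_iUnion.mp hx
    obtain ⟨n, hn⟩ := Set.mem_iUnion.mp hgx
    exact hind (max m n) x (hmono (le_max_left _ _) hm) g hg (hmono (le_max_right _ _) hn)
  · obtain ⟨n, hn⟩ := Set.mem_iUnion.mp hx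
    by_cases h : x ∈ ⋃ g ∈ {g ∈ (Γ : Set G) | g ∈ K}, (g • ·) ⁻¹' M n
    · obtain ⟨g, hg, hgx⟩ := Set.mem_iUnion₂.mp h
      exact ⟨g, hg.2, Set.mem_iUnion.mpr ⟨n, hgx⟩⟩
    · refine ⟨1, h1, Set.mem_iUnion.mpr ⟨n + 1, ?_⟩⟩
      rw [one_smul, hsucc]
      exact Or.inr ⟨hn, h⟩

/-- A countable union of Borel sets with locally finite returns has a Borel maximal independent
subset, which may be chosen to contain a given independent Borel set. -/
theorem exists_maximal_indepSet {G X ι : Type*} [Countable ι] [Nonempty ι] [Group G]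
    [MeasurableSpace G]
    [MeasurableSpace X] [StandardBorelSpace X] [MulAction G X] [MeasurableConstSMul G X]
    (hfree : ∀ (g : G) (x : X), g • x = x → g = 1)
    {Γ : Subgroup G} (hΓ : (Γ : Set G).Countable) {K : Set G} (h1 : (1 : G) ∈ K)
    (hinv : ∀ g ∈ K, g⁻¹ ∈ K) {A : ι → Set X} (hA : ∀ i, MeasurableSet (A i))
    (hret : ReturnsIn Γ (⋃ i, A i)) (hfin : ∀ i x, {g ∈ K | g • x ∈ A i}.Finite)
    {M₀ : Set X} (hM₀ : MeasurableSet M₀) (hM₀K : IndepSet K M₀) (hM₀A : M₀ ⊆ ⋃ i, A i) :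
    ∃ M : Set X, MeasurableSet M ∧ M₀ ⊆ M ∧ M ⊆ ⋃ i, A i ∧ IndepSet K M ∧
      ∀ x ∈ ⋃ i, A i, ∃ g ∈ K, g • x ∈ M := by
  choose P hPm hPK hPA using fun i => exists_nat_cover_indepSet hfree hΓ (hA i)
    (hret.mono (Set.subset_iUnion A i)) (hfin i)
  obtain ⟨e, he⟩ := exists_surjective_nat (ι × ℕ)
  have hU : ⋃ n, P (e n).1 (e n).2 = ⋃ i, A i := by
    rw [he.iUnion_comp fun p : ι × ℕ => P p.1 p.2, Set.iUnion_prod']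
    simp_rw [hPA]
  rw [← hU] at hret hM₀A ⊢
  exact exists_maximal_indepSet_of_iUnion hΓ h1 hinv (fun n => hPm _ _) (fun n => hPK _ _) hret
    hM₀ hM₀K hM₀A

/-! ### Syndetic sets and their splitting -/

/-- An independent complete section with returns in a dense countable group extends to a syndetic
one. -/
theorem exists_syndetic_superset {G X : Type*} [Group G] [TopologicalSpace G]
    [IsTopologicalGroup G] [MeasurableSpace G]
    [MeasurableSpace X] [StandardBorelSpace X] [MulAction G X] [MeasurableConstSMul G X]
    (hfree : ∀ (g : G) (x : X), g • x = x → g = 1)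
    {Γ : Subgroup G} (hΓ : (Γ : Set G).Countable) (hΓd : Dense (Γ : Set G))
    {V : Set G} (hV : V ∈ 𝓝 (1 : G)) (hVc : IsCompact V) (hinv : ∀ g ∈ V, g⁻¹ ∈ V)
    {C : Set X} (hC : MeasurableSet C) (hCV : IndepSet V C) (hCΓ : ReturnsIn Γ C)
    (hmeet : ∀ x : X, ∃ g : G, g • x ∈ C) :
    ∃ M : Set X, MeasurableSet M ∧ C ⊆ M ∧ IndepSet V M ∧ ReturnsIn Γ M ∧ IsSyndetic G M := by
  have : Countable Γ := hΓ.to_subtype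
  have hret : ReturnsIn Γ (⋃ γ : Γ, ((γ : G) • · : X → X) ⁻¹' C) := by
    intro x hx g hgx
    obtain ⟨γ, hγ⟩ := Set.mem_iUnion.mp hx
    obtain ⟨δ, hδ⟩ := Set.mem_iUnion.mp hgx
    have := hCΓ _ hγ (δ * g * (γ : G)⁻¹) (by simpa [mul_smul] using hδ)
    have h2 := Γ.mul_mem (Γ.mul_mem (Γ.inv_mem δ.2) this) γ.2
    simpa [mul_assoc] using h2
  obtain ⟨M, hM, hCM, hMC, hMV, hmax⟩ := exists_maximal_indepSet hfree hΓ (mem_of_mem_nhds hV) hinv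
    (A := fun γ : Γ => ((γ : G) • · : X → X) ⁻¹' C) (fun γ => measurable_const_smul (γ : G) hC) hret
    (fun γ x => by
      refine ((hCV.finite_returns hV (hVc.image (continuous_const_mul (γ : G))) x).preimage
        (f := fun g => (γ : G) * g) (mul_right_injective _).injOn).subset fun g hg => ?_
      exact ⟨⟨g, hg.1, rfl⟩, by simpa [mul_smul] using hg.2⟩)
    hC hCV fun x hx => Set.mem_iUnion.mpr ⟨1, by simpa using hx⟩
  refine ⟨M, hM, hCM, hMV, hret.mono hMC, Set.image2 (· * ·) V V, ?_, fun x => ?_⟩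
  · rw [← Set.image_uncurry_prod]
    exact (hVc.prod hVc).image continuous_mul
  · obtain ⟨h, hh⟩ := hmeet x
    -- With `h • x ∈ C`, choose `γ ∈ Γ` near `h⁻¹`: then `γ • h • x` is in `Γ • C` and `γ * h ∈ V`.
    -- Maximality costs one more factor from `V`.
    have hnhds : {γ : G | γ * h ∈ V} ∈ 𝓝 h⁻¹ :=
      (continuous_mul_const h).continuousAt.preimage_mem_nhds (by simpa using hV)
    obtain ⟨γ, hγ, hγV⟩ := hΓd.inter_nhds_nonempty hnhds
    obtain ⟨v, hv, hvM⟩ := hmax (γ • h • x)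
      (Set.mem_iUnion.mpr ⟨⟨γ⁻¹, Γ.inv_mem hγ⟩, by simpa using hh⟩)
    exact ⟨v * (γ * h), ⟨v, hv, γ * h, hγV, rfl⟩, by simpa [mul_smul] using hvM⟩

/-- Take `h` with `h⁻¹ ∉ L`, and `M` maximal independent for a `K` containing `L * h`. From a point
of `M`, moving by `h` and returning to `R` through `L` is a nontrivial move in `K`, so it lands in
`R \ M`. -/
theorem IsSyndetic.exists_split {G X : Type*} [Group G] [TopologicalSpace G]
    [IsTopologicalGroup G] [NoncompactSpace G] [MeasurableSpace G]
    [MeasurableSpace X] [StandardBorelSpace X] [MulAction G X] [MeasurableConstSMul G X]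
    (hfree : ∀ (g : G) (x : X), g • x = x → g = 1)
    {Γ : Subgroup G} (hΓ : (Γ : Set G).Countable)
    {V : Set G} (hV : V ∈ 𝓝 (1 : G))
    {R : Set X} (hR : MeasurableSet R) (hRV : IndepSet V R) (hRΓ : ReturnsIn Γ R)
    (hsynd : IsSyndetic G R) :
    ∃ M : Set X, M ⊆ R ∧ MeasurableSet M ∧ IsSyndetic G M ∧ IsSyndetic G (R \ M) := by
  obtain ⟨L, hL, hLR⟩ := hsynd
  obtain ⟨h, hh⟩ := (Set.ne_univ_iff_exists_notMem _).mp hL.inv.ne_univ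
  let K₀ : Set G := (· * h) '' L
  have hK₀ : IsCompact K₀ := hL.image (continuous_mul_const h)
  let K : Set G := insert 1 (K₀ ∪ K₀⁻¹)
  have hK : IsCompact K := (hK₀.union hK₀.inv).insert 1
  have h1 : (1 : G) ∈ K := Set.mem_insert _ _
  have hinv : ∀ g ∈ K, g⁻¹ ∈ K := by
    rintro g (rfl | hg | hg)
    · simpa using h1
    · exact Or.inr (Or.inr (by simpa using hg))
    · exact Or.inr (Or.inl hg)
  obtain ⟨M, hM, -, hMR, hMK, hmax⟩ := exists_maximal_indepSet hfree hΓ h1 hinv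
    (A := fun _ : Unit => R) (fun _ => hR) (by rwa [Set.iUnion_const])
    (fun _ x => hRV.finite_returns hV hK x) (M₀ := ∅) MeasurableSet.empty (fun x hx => hx.elim)
    (Set.empty_subset _)
  rw [Set.iUnion_const] at hMR hmax
  have hKL : IsCompact (Set.image2 (· * ·) K L) := by
    rw [← Set.image_uncurry_prod]
    exact (hK.prod hL).image continuous_mul
  refine ⟨M, hMR, hM, ⟨_, hKL, fun x => ?_⟩, ⟨_, hKL, fun x => ?_⟩⟩
  · obtain ⟨g, hg, hgx⟩ := hLR x
    obtain ⟨k, hk, hkx⟩ := hmax _ hgx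
    exact ⟨k * g, ⟨k, hk, g, hg, rfl⟩, by rwa [mul_smul]⟩
  · obtain ⟨g, hg, hgx⟩ := hLR x
    by_cases hgM : g • x ∈ M
    · obtain ⟨l, hl, hlx⟩ := hLR (h • g • x)
      have hlK : l * h ∈ K := Or.inr (Or.inl ⟨l, hl, rfl⟩)
      refine ⟨l * h * g, ⟨l * h, hlK, g, hg, rfl⟩, by simpa [mul_smul] using hlx, fun hmem => hh ?_⟩
      have := hMK _ hgM _ hlK (by simpa [mul_smul] using hmem)
      rw [mul_eq_one_iff_eq_inv] at this
      simpa [← this] using hl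
    · exact ⟨1 * g, ⟨1, h1, g, hg, rfl⟩, by simpa using ⟨hgx, hgM⟩⟩

theorem IsSyndetic.exists_disjoint_seq {G X : Type*} [Group G] [TopologicalSpace G]
    [IsTopologicalGroup G] [NoncompactSpace G] [MeasurableSpace G]
    [MeasurableSpace X] [StandardBorelSpace X] [MulAction G X] [MeasurableConstSMul G X]
    (hfree : ∀ (g : G) (x : X), g • x = x → g = 1)
    {Γ : Subgroup G} (hΓ : (Γ : Set G).Countable)
    {V : Set G} (hV : V ∈ 𝓝 (1 : G))
    {C : Set X} (hC : MeasurableSet C) (hCV : IndepSet V C) (hCΓ : ReturnsIn Γ C)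
    (hsynd : IsSyndetic G C) :
    ∃ T : ℕ → Set X, (∀ n, MeasurableSet (T n)) ∧ (∀ n, T n ⊆ C) ∧
      (∀ n, IsSyndetic G (T n)) ∧ ∀ m n x, x ∈ T m → x ∈ T n → m = n := by
  let S := {R : Set X // R ⊆ C ∧ MeasurableSet R ∧ IsSyndetic G R}
  have hsplit : ∀ R : S, ∃ M : S, M.1 ⊆ R.1 ∧ IsSyndetic G (R.1 \ M.1) := fun R => by
    obtain ⟨M, hMR, hM, hMs, hMs'⟩ := R.2.2.2.exists_split hfree hΓ hV R.2.2.1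
      (hCV.mono R.2.1) (hCΓ.mono R.2.1)
    exact ⟨⟨M, hMR.trans R.2.1, hM, hMs⟩, hMR, hMs'⟩
  choose next hnext hnext' using hsplit
  let R : ℕ → S := fun n => next^[n] ⟨C, subset_rfl, hC, hsynd⟩
  have hsucc : ∀ n, R (n + 1) = next (R n) := fun n => Function.iterate_succ_apply' next n _
  have hanti : Antitone fun n => (R n).1 := antitone_nat_of_succ_le fun n => by
    rw [hsucc]; exact hnext _
  refine ⟨fun n => (R n).1 \ (R (n + 1)).1, fun n => (R n).2.2.1.diff (R (n + 1)).2.2.1,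
    fun n => Set.sdiff_subset.trans (R n).2.1, fun n => ?_, fun m n x hm hn => ?_⟩
  · simp only [hsucc]; exact hnext' _
  · by_contra hne
    rcases Nat.lt_or_gt_of_ne hne with h | h
    · exact hm.2 (hanti (Nat.succ_le_of_lt h) hn.1)
    · exact hn.2 (hanti (Nat.succ_le_of_lt h) hm.1)

/-! ### Labels that separate points -/

/-- Countably many Borel labels distinguish the points of a syndetic independent set by their
labelled returns. -/
theorem IsSyndetic.exists_generator {G X : Type*} [Group G] [TopologicalSpace G]
    [IsTopologicalGroup G] [NoncompactSpace G] [MeasurableSpace G]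
    [MeasurableSpace X] [StandardBorelSpace X] [MulAction G X] [MeasurableConstSMul G X]
    (hfree : ∀ (g : G) (x : X), g • x = x → g = 1)
    {Γ : Subgroup G} (hΓ : (Γ : Set G).Countable)
    {V : Set G} (hV : V ∈ 𝓝 (1 : G))
    {C : Set X} (hC : MeasurableSet C) (hCV : IndepSet V C) (hCΓ : ReturnsIn Γ C)
    (hsynd : IsSyndetic G C) :
    ∃ f : X → ℕ, Measurable f ∧ ∀ x ∈ C, ∀ y ∈ C,
      (∀ g : G, g • x ∈ C → g • y ∈ C ∧ f (g • x) = f (g • y)) → x = y := by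
  obtain ⟨T, hTm, hTC, hTs, hTd⟩ := hsynd.exists_disjoint_seq hfree hΓ hV hC hCV hCΓ
  choose L hLc hL using hTs
  obtain ⟨B, hBm, hB⟩ := exists_nat_measurable_separating X
  have : Countable Γ := hΓ.to_subtype
  -- If `g ∈ L n` brings `x` into `T n`, then `g⁻¹` leads back to `x`; hence the window `γ⁻¹ ∈ L n`.
  let P : ℕ × Finset Γ → Set X := fun p => T p.1 ∩
    ⋂ γ : Γ, {y | γ ∈ p.2 ↔ ((γ : G)⁻¹ ∈ L p.1 ∧ (γ : G) • y ∈ C ∩ B p.1)}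
  have hPm : ∀ p, MeasurableSet (P p) := fun p => by
    refine (hTm p.1).inter (MeasurableSet.iInter fun γ => ?_)
    have h : MeasurableSet {y : X | (γ : G) • y ∈ C ∩ B p.1} :=
      measurable_const_smul (γ : G) (hC.inter (hBm p.1))
    exact (MeasurableSet.const _).iff ((MeasurableSet.const _).inter h)
  have hcover : ∀ n, ∀ y ∈ T n, ∃ F, y ∈ P (n, F) := fun n y hy => by
    have hfin : {γ : Γ | (γ : G)⁻¹ ∈ L n ∧ (γ : G) • y ∈ C ∩ B n}.Finite := by
      refine ((hCV.finite_returns hV (hLc n).inv y).preimage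
        Subtype.val_injective.injOn).subset fun γ hγ => ?_
      exact ⟨hγ.1, hγ.2.1⟩
    exact ⟨hfin.toFinset, hy, Set.mem_iInter.mpr fun γ => by simp⟩
  obtain ⟨e, he⟩ := exists_surjective_nat (ℕ × Finset Γ)
  classical
  -- The shift by one reserves `0` for points in no `P (e i)`, so a positive label names a set
  -- containing the point.
  let f : X → ℕ := fun y => if h : ∃ i, y ∈ P (e i) then Nat.find h + 1 else 0
  have hf : ∀ y i, f y = i + 1 → y ∈ P (e i) := fun y i hi => by
    by_cases h : ∃ i, y ∈ P (e i)
    · have : Nat.find h = i := by simpa [f, h] using hi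
      exact this ▸ Nat.find_spec h
    · simp [f, h] at hi
  have hfm : Measurable f := by
    have hS : MeasurableSet {y | ∃ i, y ∈ P (e i)} := by
      rw [Set.ofPred_exists]
      exact MeasurableSet.iUnion fun i => hPm (e i)
    -- The extra disjunct makes the search total, as `measurable_find` needs.
    have hq : ∀ y, ∃ i, y ∈ P (e i) ∨ ¬ ∃ i, y ∈ P (e i) := fun y => by
      by_cases h : ∃ i, y ∈ P (e i)
      · exact h.imp fun i hi => Or.inl hi
      · exact ⟨0, Or.inr h⟩
    have hm := measurable_find hq fun i => (hPm (e i)).union hS.compl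
    have : f = fun y => if ∃ i, y ∈ P (e i) then Nat.find (hq y) + 1 else 0 := by
      funext y
      by_cases h : ∃ i, y ∈ P (e i)
      · simp only [f, h, dif_pos, if_true, not_true, or_false]
      · simp only [f, h, dif_neg, not_false_iff, if_false]
    rw [this]
    exact Measurable.ite hS (hm.add_const 1) measurable_const
  refine ⟨f, hfm, fun x hx y hy hxy => ?_⟩
  by_contra hne
  obtain ⟨n, hxn, hn⟩ := hB x {y} (Set.finite_singleton y) hne
  obtain ⟨g, hg, hgx⟩ := hL n x
  obtain ⟨hgy, hfg⟩ := hxy g (hTC n hgx)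
  obtain ⟨F, hF⟩ := hcover n _ hgx
  have hex : ∃ i, g • x ∈ P (e i) := by
    obtain ⟨i, hi⟩ := he (n, F)
    exact ⟨i, hi ▸ hF⟩
  have hfx : f (g • x) = Nat.find hex + 1 := dif_pos hex
  have hgxP := hf _ _ hfx
  have hgyP := hf _ _ (hfg ▸ hfx)
  -- Disjointness of the `T n` lets the label determine `n`. The pattern then contains `g⁻¹` exactly
  -- when the starting point is in `B n`.
  have hen : (e (Nat.find hex)).1 = n := hTd _ _ _ hgxP.1 hgx
  have hgΓ : g ∈ Γ := hCΓ x hx g (hTC n hgx)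
  have h1 := (Set.mem_iInter.mp hgxP.2 ⟨g⁻¹, Γ.inv_mem hgΓ⟩).mpr
    (by rw [hen]; simpa using ⟨hg, hx, hxn⟩)
  have h2 := (Set.mem_iInter.mp hgyP.2 ⟨g⁻¹, Γ.inv_mem hgΓ⟩).mp h1
  rw [hen] at h2
  exact hn y rfl (by simpa using h2.2.2)

/-! ### Marker elements -/

theorem nhdsNE_neBot_of_not_discreteTopology {G : Type*} [Group G] [TopologicalSpace G]
    [IsTopologicalGroup G] (hnd : ¬ DiscreteTopology G) (x : G) : (𝓝[≠] x).NeBot := by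
  refine ⟨fun h => hnd ?_⟩
  rw [← isOpen_singleton_iff_punctured_nhds] at h
  exact (MulAction.IsPretransitive.discreteTopology_iff G x).mpr h

theorem exists_mem_nhds_dense_notMem_finite {G : Type*} [Group G] [TopologicalSpace G]
    [IsTopologicalGroup G] [T2Space G] (hnd : ¬ DiscreteTopology G) {Γ : Set G} (hΓ : Dense Γ)
    {N : Set G} {b : G} (hN : N ∈ 𝓝 b) {F : Set G} (hF : F.Finite) : ∃ g ∈ N, g ∈ Γ ∧ g ∉ F := by
  have := nhdsNE_neBot_of_not_discreteTopology hnd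
  obtain ⟨g, hg⟩ := (hΓ.sdiff_finite hF).inter_nhds_nonempty hN
  exact ⟨g, hg.2, hg.1⟩

/-- Small elements `a` and `s n` of a dense subgroup such that the configurations `{1, a, s n}` are
uniformly discrete and `1` is distinguished in each of them by its position. -/
theorem exists_marker_elements {G : Type*} [Group G] [TopologicalSpace G]
    [IsTopologicalGroup G] [T2Space G] (hnd : ¬ DiscreteTopology G) {Γ : Set G} (hΓ : Dense Γ)
    {W : Set G} (hW : W ∈ 𝓝 (1 : G)) :
    ∃ a ∈ W, ∃ s : ℕ → G, ∃ O ∈ 𝓝 (1 : G), a ∈ Γ ∧ a ≠ 1 ∧ Function.Injective s ∧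
      (∀ n, s n ∈ W ∧ s n ∈ Γ ∧ a * s n ≠ 1) ∧ (∀ m n, s m * a ≠ s n) ∧
      (∀ o ∈ O, o ≠ a ∧ o * a ≠ 1) ∧
      ∀ o ∈ O, ∀ n, o ≠ s n ∧ o * s n ≠ 1 ∧ o * a ≠ s n ∧ o * s n ≠ a := by
  obtain ⟨a, haW, haΓ, ha⟩ := exists_mem_nhds_dense_notMem_finite hnd hΓ hW (Set.finite_singleton 1)
  -- All `s n` will be taken near `b`. Each requirement on them holds at `b` and is open, hence
  -- holds uniformly in `n`.
  obtain ⟨b, hbW, -, hb⟩ := exists_mem_nhds_dense_notMem_finite hnd hΓ (interior_mem_nhds.mpr hW)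
    (F := {1, a, a⁻¹}) (by simp)
  simp only [Set.mem_insert_iff, Set.mem_singleton_iff, not_or] at ha hb
  obtain ⟨hb1, hba, hba'⟩ := hb
  have key : ∀ᶠ p : G × G in 𝓝 (1, b),
      p.1 ≠ p.2 ∧ p.1 * p.2 ≠ 1 ∧ p.1 * a ≠ p.2 ∧ p.1 * p.2 ≠ a := by
    refine Filter.Eventually.and ?_ (Filter.Eventually.and ?_ (Filter.Eventually.and ?_ ?_))
    · exact (isOpen_ne_fun continuous_fst continuous_snd).mem_nhds (Ne.symm hb1)
    · exact (continuous_fst.mul continuous_snd).continuousAt.eventually_ne (by simpa using hb1)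
    · exact (isOpen_ne_fun (continuous_fst.mul continuous_const) continuous_snd).mem_nhds
        (by simpa using Ne.symm hba)
    · exact (continuous_fst.mul continuous_snd).continuousAt.eventually_ne (by simpa using hba)
  have key2 : ∀ᶠ p : G × G in 𝓝 (b, b), p.1 * a ≠ p.2 :=
    (isOpen_ne_fun (continuous_fst.mul continuous_const) continuous_snd).mem_nhds
      (by simpa using ha)
  obtain ⟨O, hO, N, hN, hON⟩ := mem_nhds_prod_iff.mp key
  obtain ⟨N₁, hN₁, N₂, hN₂, hNN⟩ := mem_nhds_prod_iff.mp key2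
  have hne : ∀ᶠ g in 𝓝 b, a * g ≠ 1 :=
    (continuous_const_mul a).continuousAt.eventually_ne
      (by simpa [mul_eq_one_iff_eq_inv'] using hba')
  have hNb : N ∩ N₁ ∩ N₂ ∩ {g | a * g ≠ 1} ∩ W ∈ 𝓝 b :=
    Filter.inter_mem (Filter.inter_mem (Filter.inter_mem (Filter.inter_mem hN hN₁) hN₂) hne)
      (mem_interior_iff_mem_nhds.mp hbW)
  have hinf : ({g | g ∈ N ∩ N₁ ∩ N₂ ∩ {g | a * g ≠ 1} ∩ W ∧ g ∈ Γ}).Infinite := fun hfin => by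
    obtain ⟨g, hg, hgΓ, hgF⟩ := exists_mem_nhds_dense_notMem_finite hnd hΓ hNb hfin
    exact hgF ⟨hg, hgΓ⟩
  let s := hinf.natEmbedding
  have hOa : ∀ᶠ o in 𝓝 (1 : G), o ≠ a ∧ o * a ≠ 1 :=
    (continuousAt_id.eventually_ne (Ne.symm ha)).and
      ((continuous_mul_const a).continuousAt.eventually_ne (by simpa using ha))
  refine ⟨a, haW, fun n => s n, O ∩ {o | o ≠ a ∧ o * a ≠ 1}, Filter.inter_mem hO hOa, haΓ, ha,
    Subtype.val_injective.comp s.injective, fun n => ?_, fun m n => ?_, fun o ho => ho.2,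
    fun o ho n => ?_⟩
  · exact ⟨(s n).2.1.2, (s n).2.2, (s n).2.1.1.2⟩
  · exact hNN (Set.mk_mem_prod (s m).2.1.1.1.1.2 (s n).2.1.1.1.2)
  · exact hON (Set.mk_mem_prod ho.1 (s n).2.1.1.1.1.1)

/-! ### Independence, lacunarity and visit sets -/

theorem IsLacunaryWith.indepSet {G X : Type*} [Group G] [MulAction G X]
    (hfree : ∀ (g : G) (x : X), g • x = x → g = 1) {U V : Set G} {C : Set X}
    (hC : IsLacunaryWith U C) (h1 : (1 : G) ∈ U) (hVU : V ⊆ U) : IndepSet V C := by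
  intro x hx g hg hgx
  by_contra hne
  have h := hC x hx (g • x) hgx fun h => hne (hfree g x h.symm)
  have hmem : g • x ∈ ((fun g : G => g • x) '' U) ∩ ((fun h : G => h • g • x) '' U) :=
    ⟨⟨g, hVU hg, rfl⟩, ⟨1, h1, one_smul _ _⟩⟩
  rw [h] at hmem
  exact hmem

theorem IndepSet.isLacunary {G X : Type*} [Group G] [TopologicalSpace G] [IsTopologicalGroup G]
    [MulAction G X] {O : Set G} (hO : O ∈ 𝓝 (1 : G)) {D : Set X} (hD : IndepSet O D) :
    IsLacunary G D := by
  obtain ⟨Q, hQ, hQO⟩ := exists_nhds_one_mul_inv_subset hO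
  refine ⟨Q⁻¹, inv_mem_nhds_one G hQ, fun x hx y hy hxy => ?_⟩
  rw [Set.eq_empty_iff_forall_notMem]
  rintro _ ⟨⟨p, hp, rfl⟩, ⟨q, hq, hpq⟩⟩
  have hyx : (q⁻¹ * p) • x = y := by
    rw [mul_smul, inv_smul_eq_iff]
    exact hpq.symm
  have hmem : q⁻¹ * p ∈ O := by simpa using hQO _ hq _ hp
  have h1 := hD x hx _ hmem (hyx ▸ hy)
  rw [h1, one_smul] at hyx
  exact hxy hyx

/-- Every `k` has a neighbourhood with at most one visit time, so visit times do not accumulate.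
Visits are inverses of returns, hence the condition on `g⁻¹ * k`. -/
theorem IndepSet.isClosed_and_discrete_visitSet {G X : Type*} [Group G] [TopologicalSpace G]
    [IsTopologicalGroup G] [T2Space G] [MulAction G X] {O : Set G} (hO : O ∈ 𝓝 (1 : G)) {D : Set X}
    (hD : IndepSet O D) (x : X) :
    IsClosed (visitSet G D x) ∧ IsDiscrete (visitSet G D x) := by
  obtain ⟨Q, hQ, hQO⟩ := exists_nhds_one_mul_inv_subset hO
  rw [isClosed_and_discrete_iff]
  intro k
  have hN : {g : G | g⁻¹ * k ∈ Q} ∈ 𝓝 k :=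
    (continuous_inv.mul continuous_const).continuousAt.preimage_mem_nhds (by simpa using hQ)
  have hsub : ({g : G | g⁻¹ * k ∈ Q} ∩ visitSet G D x).Subsingleton := by
    intro g hg h hh
    exact inv_injective (hD.eq_of_mul_mem hQO (k := k⁻¹) hg.2 hh.2 (by simpa using hg.1)
      (by simpa using hh.1))
  have hmem : (({g : G | g⁻¹ * k ∈ Q} ∩ visitSet G D x) \ {k})ᶜ ∈ 𝓝 k :=
    (hsub.finite.subset Set.sdiff_subset).isClosed.isOpen_compl.mem_nhds fun h => h.2 rfl
  rw [Filter.disjoint_principal_right]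
  filter_upwards [nhdsWithin_le_nhds hN, nhdsWithin_le_nhds hmem, self_mem_nhdsWithin]
    with g h1 h2 h3 hg
  exact h2 ⟨⟨h1, hg⟩, h3⟩

theorem returnsIn_iff_orbitCocycle {G X : Type*} [Group G] [MulAction G X]
    (hfree : ∀ (g : G) (x : X), g • x = x → g = 1) {Γ : Subgroup G} {C : Set X} :
    ReturnsIn Γ C ↔ orbitCocycle '' orbitEquivRelOn G C ⊆ (Γ : Set G) := by
  constructor
  · rintro h _ ⟨p, hp, rfl⟩
    exact h p.1.1 hp.1 _ (by rw [orbitCocycle_smul]; exact hp.2)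
  · intro h x hx g hgx
    let p : orbitEquivRel G X := ⟨(x, g • x), g, rfl⟩
    rw [← orbitCocycle_unique hfree p g rfl]
    exact h ⟨p, ⟨hx, hgx⟩, rfl⟩

/-! ### The marked set and the conclusion -/

/-- The set obtained from `C` by adding to every point `c` the points `a • c` and `s (f c) • c`. -/
def markedSet {G X : Type*} [Group G] [MulAction G X] (C : Set X) (a : G) (s : ℕ → G)
    (f : X → ℕ) : Set X :=
  {y | ∃ c ∈ C, y = c ∨ y = a • c ∨ y = s (f c) • c}

theorem measurableSet_markedSet {G X : Type*} [Group G] [MeasurableSpace G] [MeasurableSpace X]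
    [MulAction G X] [MeasurableConstSMul G X] {C : Set X} (hC : MeasurableSet C) (a : G) (s : ℕ → G)
    {f : X → ℕ} (hf : Measurable f) : MeasurableSet (markedSet C a s f) := by
  have : markedSet C a s f = C ∪ (a⁻¹ • ·) ⁻¹' C ∪
      ⋃ n, ((s n)⁻¹ • ·) ⁻¹' (C ∩ f ⁻¹' {n}) := by
    ext y
    simp only [markedSet, Set.mem_ofPred_eq, Set.mem_union, Set.mem_iUnion, Set.mem_preimage,
      Set.mem_inter_iff, Set.mem_singleton_iff]
    constructor
    · rintro ⟨c, hc, rfl | rfl | rfl⟩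
      · exact Or.inl (Or.inl hc)
      · exact Or.inl (Or.inr (by simpa using hc))
      · exact Or.inr ⟨f c, by simpa using hc⟩
    · rintro ((h | h) | ⟨n, h, hn⟩)
      · exact ⟨y, h, Or.inl rfl⟩
      · exact ⟨_, h, Or.inr (Or.inl (by simp))⟩
      · exact ⟨_, h, Or.inr (Or.inr (by simp [hn]))⟩
  rw [this]
  exact (hC.union (measurable_const_smul a⁻¹ hC)).union (MeasurableSet.iUnion fun n =>
    measurable_const_smul (s n)⁻¹ (hC.inter (hf (measurableSet_singleton n))))

theorem ReturnsIn.markedSet {G X : Type*} [Group G] [MulAction G X] {Γ : Subgroup G} {C : Set X}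
    (hC : ReturnsIn Γ C) {a : G} (ha : a ∈ Γ) {s : ℕ → G} (hs : ∀ n, s n ∈ Γ) (f : X → ℕ) :
    ReturnsIn Γ (markedSet C a s f) := by
  have hmem : ∀ y ∈ _root_.markedSet C a s f, ∃ c ∈ C, ∃ u ∈ Γ, y = u • c := by
    rintro y ⟨c, hc, rfl | rfl | rfl⟩
    exacts [⟨y, hc, 1, Γ.one_mem, (one_smul _ _).symm⟩, ⟨c, hc, a, ha, rfl⟩, ⟨c, hc, _, hs _, rfl⟩]
  intro x hx g hgx
  obtain ⟨c, hc, u, hu, rfl⟩ := hmem x hx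
  obtain ⟨d, hd, v, hv, hvd⟩ := hmem _ hgx
  have h : (v⁻¹ * g * u) • c = d := by
    rw [mul_smul, mul_smul, inv_smul_eq_iff, hvd]
  have h2 := hC c hc _ (h ▸ hd)
  have h3 := Γ.mul_mem (Γ.mul_mem hv h2) (Γ.inv_mem hu)
  simpa [mul_assoc] using h3

/-- Near a point of `C` the marked set consists of its three marked points only. -/
theorem IndepSet.mem_of_smul_mem_markedSet {G X : Type*} [Group G] [MulAction G X]
    {V W : Set G} {C : Set X}
    (hC : IndepSet V C) (hW : ∀ u ∈ W, ∀ v ∈ W, ∀ w ∈ W, u⁻¹ * (v * w) ∈ V) (h1 : (1 : G) ∈ W)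
    {a : G} (ha : a ∈ W) {s : ℕ → G} (hs : ∀ n, s n ∈ W) {f : X → ℕ} {c : X} (hc : c ∈ C)
    {v w : G} (hv : v ∈ W) (hw : w ∈ W) (h : (v * w) • c ∈ markedSet C a s f) :
    v * w = 1 ∨ v * w = a ∨ v * w = s (f c) := by
  have key : ∀ d ∈ C, ∀ u ∈ W, (v * w) • c = u • d → v * w = u ∧ d = c := by
    intro d hd u hu hud
    have hd' : (u⁻¹ * (v * w)) • c = d := by rw [mul_smul, inv_smul_eq_iff, hud]
    have h2 := hC c hc _ (hW u hu v hv w hw) (hd' ▸ hd)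
    rw [h2, one_smul] at hd'
    exact ⟨(inv_mul_eq_one.mp h2).symm, hd'.symm⟩
  obtain ⟨d, hd, h | h | h⟩ := h
  · exact Or.inl (key d hd 1 h1 (by rw [h, one_smul])).1
  · exact Or.inr (Or.inl (key d hd a ha h).1)
  · obtain ⟨h2, rfl⟩ := key d hd _ (hs _) h
    exact Or.inr (Or.inr h2)

theorem lemma2p1 {G X : Type*}
    [Group G] [TopologicalSpace G] [IsTopologicalGroup G] [T2Space G] [LocallyCompactSpace G]
    [SecondCountableTopology G] [NoncompactSpace G] (hnd : ¬ DiscreteTopology G)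
    [MeasurableSpace G] [BorelSpace G]
    [MeasurableSpace X] [StandardBorelSpace X] [MulAction G X] [MeasurableSMul₂ G X]
    (hfree : ∀ (g : G) (x : X), g • x = x → g = 1)
    (Γ : Subgroup G) (hΓc : (Γ : Set G).Countable) (hΓd : Dense (Γ : Set G))
    (C : Set X) (hC : IsBorelCrossSection G C) (hClac : IsLacunary G C)
    (hCΓ : orbitCocycle '' orbitEquivRelOn G C ⊆ (Γ : Set G)) :
    ∃ D : Set X, C ⊆ D ∧ IsBorelCrossSection G D ∧ IsLacunary G D ∧ IsSeparating G D ∧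
      orbitCocycle '' orbitEquivRelOn G D ⊆ (Γ : Set G) := by
  obtain ⟨U, hU, hCU⟩ := hClac
  obtain ⟨V₀, hV₀, hV₀U, hV₀c⟩ := LocallyCompactSpace.local_compact_nhds (1 : G) U hU
  let V : Set G := V₀ ∩ V₀⁻¹
  have hV : V ∈ 𝓝 (1 : G) := Filter.inter_mem hV₀ (inv_mem_nhds_one G hV₀)
  have hVc : IsCompact V := hV₀c.inter hV₀c.inv
  obtain ⟨M, hM, hCM, hMV, hMΓ, hMs⟩ := exists_syndetic_superset hfree hΓc hΓd hV hVc
    (fun g hg => ⟨hg.2, by simpa using hg.1⟩) hC.measurableSet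
    (hCU.indepSet hfree (mem_of_mem_nhds hU) (Set.inter_subset_left.trans hV₀U))
    ((returnsIn_iff_orbitCocycle hfree).mpr hCΓ) fun x => by
      obtain ⟨_, ⟨g, rfl⟩, hg⟩ := hC.meets_orbit x
      exact ⟨g, hg⟩
  obtain ⟨f, hf, hfM⟩ := hMs.exists_generator hfree hΓc hV hM hMV hMΓ
  obtain ⟨W₀, hW₀, hW₀V⟩ := exists_nhds_one_split4 hV
  let W : Set G := W₀ ∩ W₀⁻¹
  have hWn : W ∈ 𝓝 (1 : G) := Filter.inter_mem hW₀ (inv_mem_nhds_one G hW₀)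
  have h1 : (1 : G) ∈ W := mem_of_mem_nhds hWn
  have hW : ∀ u ∈ W, ∀ v ∈ W, ∀ w ∈ W, u⁻¹ * (v * w) ∈ V := fun u hu v hv w hw => by
    simpa [mul_assoc] using hW₀V hu.2 hv.1 hw.1 h1.1
  obtain ⟨a, haW, s, O, hO, haΓ, ha, hsinj, hs, hsa, hOa, hOs⟩ :=
    exists_marker_elements hnd hΓd hWn
  have hnear : ∀ {c : X}, c ∈ M → ∀ {v w : G}, v ∈ W → w ∈ W →
      (v * w) • c ∈ markedSet M a s f → v * w = 1 ∨ v * w = a ∨ v * w = s (f c) :=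
    fun hc _ _ => hMV.mem_of_smul_mem_markedSet hW h1 haW (fun n => (hs n).1) hc
  have hMD : M ⊆ markedSet M a s f := fun c hc => ⟨c, hc, Or.inl rfl⟩
  -- A small move between marked points stays within the configuration of one `c`; the choice of `O`
  -- leaves only `o = 1`.
  have hDO : IndepSet (O ∩ W) (markedSet M a s f) := by
    rintro x ⟨c, hc, rfl | rfl | rfl⟩ o ho hox
    · have := hnear hc ho.2 h1 (by simpa using hox)
      rw [mul_one] at this
      rcases this with h | h | h
      exacts [h, absurd h (hOa o ho.1).1, absurd h (hOs o ho.1 _).1]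
    · rcases hnear hc ho.2 haW (by rwa [mul_smul]) with h | h | h
      exacts [absurd h (hOa o ho.1).2, mul_eq_right.mp h, absurd h (hOs o ho.1 _).2.2.1]
    · rcases hnear hc ho.2 (hs _).1 (by rwa [mul_smul]) with h | h | h
      exacts [absurd h (hOs o ho.1 _).2.1, absurd h (hOs o ho.1 _).2.2.2, mul_eq_right.mp h]
  have hOW : O ∩ W ∈ 𝓝 (1 : G) := Filter.inter_mem hO hWn
  have hs1 : ∀ n, s n ≠ 1 := fun n h => (hOs 1 (mem_of_mem_nhds hO) n).1 h.symm
  have hsne : ∀ n, s n ≠ a := fun n h =>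
    (hOs 1 (mem_of_mem_nhds hO) n).2.2.2 (by rwa [one_mul])
  have hmemM : ∀ x ∈ M, ∀ y, (∀ g : G, g • x ∈ markedSet M a s f ↔ g • y ∈ markedSet M a s f) →
      y ∈ M := by
    intro x hx y hxy
    have hy : y ∈ markedSet M a s f := by simpa using (hxy 1).mp (by simpa using hMD hx)
    have hay : a • y ∈ markedSet M a s f := (hxy a).mp ⟨x, hx, Or.inr (Or.inl rfl)⟩
    have hsy : s (f x) • y ∈ markedSet M a s f := (hxy _).mp ⟨x, hx, Or.inr (Or.inr rfl)⟩
    obtain ⟨c, hc, rfl | rfl | rfl⟩ := hy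
    · exact hc
    · rcases hnear hc (hs _).1 haW (by rwa [mul_smul]) with h | h | h
      · refine absurd ?_ (hs (f x)).2.2
        rw [mul_eq_one_iff_eq_inv] at h ⊢
        rw [h, inv_inv]
      · exact absurd (mul_eq_right.mp h) (hs1 _)
      · exact absurd h (hsa _ _)
    · rcases hnear hc haW (hs _).1 (by rwa [mul_smul]) with h | h | h
      · exact absurd h (hs _).2.2
      · exact absurd (mul_eq_left.mp h) (hs1 _)
      · exact absurd (mul_eq_right.mp h) ha
  have hsepM : ∀ x ∈ M, ∀ y,
      (∀ g : G, g • x ∈ markedSet M a s f ↔ g • y ∈ markedSet M a s f) → x = y := by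
    intro x hx y hxy
    refine hfM x hx y (hmemM x hx y hxy) fun g hgx => ?_
    have hg : ∀ h : G, h • g • x ∈ markedSet M a s f ↔ h • g • y ∈ markedSet M a s f :=
      fun h => by simpa only [mul_smul] using hxy (h * g)
    have hgy := hmemM _ hgx _ hg
    refine ⟨hgy, hsinj ?_⟩
    -- The marker of `g • x` also appears at `g • y`, where the only marker besides `1` and `a` is
    -- `s (f (g • y))`.
    have h := (hg (s (f (g • x)))).mp ⟨_, hgx, Or.inr (Or.inr rfl)⟩
    have h' := hnear hgy (hs (f (g • x))).1 h1 (by simpa using h)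
    rw [mul_one] at h'
    rcases h' with h' | h' | h'
    exacts [absurd h' (hs1 _), absurd h' (hsne _), h']
  have hvisit := hDO.isClosed_and_discrete_visitSet hOW
  refine ⟨markedSet M a s f, hCM.trans hMD,
    ⟨measurableSet_markedSet hM a s hf, fun x => ?_, fun x => (hvisit x).1,
      fun x => (hvisit x).2.to_subtype⟩,
    hDO.isLacunary hOW, fun x y hxy => ?_,
    (returnsIn_iff_orbitCocycle hfree).mp (hMΓ.markedSet haΓ (fun n => (hs n).2.1) f)⟩
  · obtain ⟨L, -, hL⟩ := hMs
    obtain ⟨g, -, hg⟩ := hL x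
    exact ⟨g • x, ⟨g, rfl⟩, hMD hg⟩
  · obtain ⟨L, -, hL⟩ := hMs
    obtain ⟨g, -, hg⟩ := hL x
    refine smul_left_cancel g (hsepM _ hg _ fun h => ?_)
    have := Set.ext_iff.mp hxy (h * g)⁻¹
    simpa [visitSet, mul_smul] using this
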